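/- **Setting.** Let $M=\langle V,U,F\rangle$ be a structural causal model: finitely many discrete (countably valued) endogenous variables $v\in V$ and exogenous variables $k\in U$; every endogenous $v$ has endogenous parents $PA_v$, exogenous parents $U_v\subseteq U$ and a structural equation $v=f_v(pa_v,u_v)$; and the graph is acyclic. The exogenous variables are mutually independent, and $P$ is their joint law; every endogenous variable is a function of $u$. For $X\in V$ and a value $x$ of $X$, let $M_x$ be the model in which $f_X$ is replaced by the constant $x$ (so all arrows into $X$ are removed), and let $Y_x(u)$ be the value of $Y\in V$ in $M_x$. **$d$-separation.** In a directed acyclic graph, a set $S$ of nodes blocks a path if the path contains a chain or a fork whose middle node is in $S$, or a collider such that neither it nor any of its descendants is in $S$; $S$ $d$-separates $a$ from $b$ if it blocks every path between $a$ and $b$. **Cross-world SCM.** A variable in $V\cup U$ is a *teleporter* if it is (unconditionally) $d$-separated from $X$ in the graph of $M_x$. The graph $\mathcal W_m$ has the following nodes: all endogenous (real-world) variables; a counterfactual copy $D_x$ of each endogenous variable $D$ that is not a teleporter (the copy of $X$ being the constant node $X=x$); and all exogenous variables except those that belong to an endogenous teleporter, that is, that are a parent of this teleporter and of no other variable. Real-world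 nodes have their parents in $M$ (as far as these were not removed). A counterfactual node $D_x$, $D\neq X$, has as parents the copies of the non-teleporter parents of $D$, the teleporter parents of $D$ themselves, and the exogenous parents of $D$; the node $X=x$ has no parents. If $Y$ is a teleporter, $Y_x$ is represented by the node $Y$. **Theorem 3 (Counterfactual criterion and cross-world adjustment).** Let $X,Y\in V$, let $x$ be a value of $X$, and let $E,Z\subseteq V$ be sets of (real-world, observable) endogenous variables. Suppose that $E\cup Z$ $d$-separates $X$ from $Y_x$ in $\mathcal W_m$. Then: 1. $X \perp\!\!\!\perp Y_x \mid \{E,Z\}$: for all values $e$ of $E$ and $z$ of $Z$ with $P(E=e,Z=z)>0$, the variables $X$ and $Y_x$ are independent under $P(\,\cdot\mid E=e,Z=z)$. 2. For every value $e$ of $E$ with $P(E=e)>0$ such that $P(Z=z,X=x,E=e)>0$ whenever $P(Z=z,E=e)>0$ (so that the conditional probabilities below are defined), and for every value $y$ of $Y$, $$P(Y_x=y\mid E=e)=\sum_z P(Y=y\mid Z=z,X=x,E=e)\,P(Z=z\mid E=e),$$ where terms with $P(Z=z\mid E=e)=0$ are read as $0$. -/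

import Mathlib

open MeasureTheory ProbabilityTheory

/-! ### Paths and d-separation in a directed graph -/

namespace Digraph

variable {N : Type*} (G : Digraph N)

/-- `p` is a path of `G` from `a` to `b`: a list of pairwise distinct nodes that starts at `a`,
ends at `b`, and in which consecutive nodes are joined by an edge of either direction. -/
def IsPathBetween (a b : N) (p : List N) : Prop :=
  p.head? = some a ∧ p.getLast? = some b ∧ p.Nodup ∧
    p.IsChain (fun c d => G.Adj c d ∨ G.Adj d c)

/-- The node set `S` blocks `p`: either `p` contains a chain or a fork whose middle node is in `S`,
or `p` contains a collider such that neither the collider node nor any descendant of it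
is in `S`. -/
def Blocks (S : Set N) (p : List N) : Prop :=
  ∃ a b c : N, [a, b, c] <:+: p ∧
    ((((G.Adj a b ∧ G.Adj b c) ∨ (G.Adj c b ∧ G.Adj b a) ∨ (G.Adj b a ∧ G.Adj b c)) ∧ b ∈ S) ∨
      ((G.Adj a b ∧ G.Adj c b) ∧ ∀ d, Relation.ReflTransGen G.Adj b d → d ∉ S))

/-- `S` d-separates `a` from `b`: it blocks every path between them. -/
def DSep (a b : N) (S : Set N) : Prop :=
  ∀ p : List N, G.IsPathBetween a b p → G.Blocks S p

end Digraph

/-! ### Structural causal models -/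

/-- A structural causal model with endogenous variables indexed by `V` (the variable `v` has
values in `Val v`) and exogenous variables indexed by `U` (the variable `k` has values in
`UVal k`): every endogenous variable `v` has endogenous parents, exogenous parents, and a
structural equation that computes its value from the values of its parents; the graph is
acyclic. -/
structure SCM (V U : Type*) (Val : V → Type*) (UVal : U → Type*) where
  /-- `parent w v`: the endogenous variable `w` is a parent of `v`. -/
  parent : V → V → Prop
  /-- `exoParent k v`: the exogenous variable `k` is a parent of `v`. -/
  exoParent : U → V → Prop
  /-- There is no directed cycle. -/
  acyclic : ∀ v, ¬ Relation.TransGen parent v v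
  /-- The structural equations. -/
  eqn : ∀ v, (∀ w : {w // parent w v}, Val w) → (∀ k : {k // exoParent k v}, UVal k) → Val v

namespace SCM

variable {V U : Type*} {Val : V → Type*} {UVal : U → Type*} (M : SCM V U Val UVal)

/-- The causal graph: nodes are all endogenous and exogenous variables, and edges point from the
(endogenous and exogenous) parents of a variable to that variable. -/
def graph : Digraph (V ⊕ U) where
  Adj a b := match a, b with
    | Sum.inl w, Sum.inl v => M.parent w v
    | Sum.inr k, Sum.inl v => M.exoParent k v
    | _, Sum.inr _ => False

theorem wellFounded_parent [Finite V] : WellFounded M.parent := by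
  have : Std.Irrefl (Relation.TransGen M.parent) := ⟨M.acyclic⟩
  have h : WellFounded (Relation.TransGen M.parent) :=
    Finite.wellFounded_of_trans_of_irrefl _
  exact Subrelation.wf (fun hab => Relation.TransGen.single hab) h

/-- `M.solve u v` is the value of the endogenous variable `v` when the exogenous variables have
the values `u`: the solution of the structural equations, by recursion along the graph. -/
noncomputable def solve [Finite V] (u : ∀ k, UVal k) : ∀ v, Val v :=
  M.wellFounded_parent.fix fun v ih => M.eqn v (fun w => ih w.1 w.2) (fun k => u k.1)

theorem solve_eq [Finite V] (u : ∀ k, UVal k) (v : V) :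
    M.solve u v = M.eqn v (fun w => M.solve u w.1) (fun k => u k.1) := by
  unfold solve
  rw [WellFounded.fix_eq]

open Classical in
/-- The model after the intervention `do(X = x)`: the equation of `X` is replaced by the constant
`x`, so that all arrows into `X` disappear; nothing else changes. -/
noncomputable def intervene (X : V) (x : Val X) : SCM V U Val UVal where
  parent w v := v ≠ X ∧ M.parent w v
  exoParent k v := v ≠ X ∧ M.exoParent k v
  acyclic v h := M.acyclic v (Relation.TransGen.mono (fun _ _ h' => h'.2) _ _ h)
  eqn v a b :=
    if h : v = X then h ▸ x
    else M.eqn v (fun w => a ⟨w.1, h, w.2⟩) (fun k => b ⟨k.1, h, k.2⟩)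

/-- The counterfactual variable `Y_x`, as a function of the exogenous values: the value of `Y` in
the model after `do(X = x)`. -/
noncomputable def potential [Finite V] (X : V) (x : Val X) (Y : V) (u : ∀ k, UVal k) : Val Y :=
  (M.intervene X x).solve u Y

/-- The event that the endogenous variables in `S` have the values `s` in the real world. -/
def event [Finite V] (S : Set V) (s : ∀ v : S, Val v) : Set (∀ k, UVal k) :=
  {u | ∀ v : S, M.solve u v = s v}

/-! ### The cross-world model -/

/-- A variable is a teleporter for the intervention `do(X = x)` if, in the counterfactual world,
it is (unconditionally) d-separated from `X`. -/
def IsTeleporter (X : V) (x : Val X) (a : V ⊕ U) : Prop :=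
  (M.intervene X x).graph.DSep (Sum.inl X) a ∅

/-- The exogenous variable `k` belongs to an endogenous teleporter: it is a parent of that
variable and of no other one. -/
def IsRemoved (X : V) (x : Val X) (k : U) : Prop :=
  ∃ z : V, M.IsTeleporter X x (Sum.inl z) ∧ ∀ v, M.exoParent k v ↔ v = z

/-- The nodes of the cross-world model: all real-world endogenous variables, the exogenous
variables that do not belong to an endogenous teleporter, and a counterfactual version of every
endogenous variable that is not a teleporter (for `X` itself this is the constant node `X = x`).
Teleporters occur once and are shared by both worlds. -/
inductive CrossNode (X : V) (x : Val X)
  | real (v : V)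
  | exo (k : U) (h : ¬ M.IsRemoved X x k)
  | cf (v : V) (h : ¬ M.IsTeleporter X x (Sum.inl v))

/-- The graph of the cross-world model. The real-world part has the edges of `M`, the
counterfactual part those of `M` after `do(X = x)`; the parents of a counterfactual node are
counterfactual nodes, teleporters (shared with the real world), and exogenous variables
(shared with the real world). -/
def crossGraph (X : V) (x : Val X) : Digraph (M.CrossNode X x) where
  Adj a b := match a, b with
    | .real w, .real v => M.parent w v
    | .exo k _, .real v => M.exoParent k v
    | .cf w _, .cf v _ => (M.intervene X x).parent w v
    | .real w, .cf v _ => M.IsTeleporter X x (Sum.inl w) ∧ (M.intervene X x).parent w v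
    | .exo k _, .cf v _ => (M.intervene X x).exoParent k v
    | .cf _ _, .real _ => False
    | _, .exo _ _ => False

open Classical in
/-- The node of the cross-world model that represents `Y_x`: the counterfactual version of `Y`,
or `Y` itself if `Y` is a teleporter. -/
noncomputable def cfNode (X : V) (x : Val X) (Y : V) : M.CrossNode X x :=
  if h : M.IsTeleporter X x (Sum.inl Y) then .real Y else .cf Y h

end SCM

/-! Both worlds are computed from one outcome `u` of independent noise, so the cross-world graph is
itself a graph of deterministic functions of that noise, and soundness of d-separation applies to
it. `crossSetoid_local` supplies the locality this needs; teleporters may be shared because their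
values agree in both worlds. Soundness is proved on outcomes, without probability. Split the noise
by whether it has an active connection to `X` given `S`. If `u` and `u'` agree on `S`, combining the
connected noise of `u` with the rest of `u'` preserves `S`, takes `X` from `u` and `Y_x` from `u'`
(`DSep.exists_recombine`). Events in `X` and `Y_x` within a conditioning event thus become
intersections of events in disjoint noise coordinates, which gives conditional independence
(`indepFun_cond_of_recombine`). For adjustment, sum over `Z`, insert `X = x` by independence, and
replace `Y_x` by `Y` by consistency (`potential_eq_solve_of_eq`). -/

namespace Digraph

/-! ### From walks with repeated nodes to paths. -/

variable {N : Type*} {G : Digraph N}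

theorem Blocks.mono {S : Set N} {p q : List N} (h : p <:+: q) : G.Blocks S p → G.Blocks S q := by
  rintro ⟨a, b, c, hi, h'⟩
  exact ⟨a, b, c, hi.trans h, h'⟩

/-- A triple in `l ++ x :: m` lies on one side of `x` or has `x` in the middle. -/
theorem triple_infix_append_cons {l m : List N} {x a b c : N} (h : [a, b, c] <:+: l ++ x :: m) :
    [a, b, c] <:+: l ++ [x] ∨ [a, b, c] <:+: x :: m ∨
      (b = x ∧ (∃ l', l = l' ++ [a]) ∧ ∃ m', m = c :: m') := by
  induction l with
  | nil => exact Or.inr (Or.inl (by simpa using h))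
  | cons d l ih =>
    rw [List.cons_append, List.infix_cons_iff] at h
    rcases h with h | h
    · match l, h with
      | [], h =>
        right; right
        simp only [List.nil_append, List.cons_prefix_cons] at h
        obtain ⟨rfl, rfl, t, ht⟩ := h
        exact ⟨rfl, ⟨[], rfl⟩, t, by simpa using ht.symm⟩
      | [e], h =>
        left
        simp only [List.cons_append, List.nil_append, List.cons_prefix_cons] at h
        obtain ⟨rfl, rfl, rfl, -⟩ := h
        exact List.infix_rfl
      | e :: f :: l, h =>
        left
        simp only [List.cons_append, List.cons_prefix_cons] at h
        obtain ⟨rfl, rfl, rfl, -⟩ := h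
        exact List.IsPrefix.isInfix ⟨l ++ [x], by simp⟩
    · rcases ih h with h' | h' | ⟨h1, ⟨l', h2⟩, h3⟩
      · exact Or.inl (by rw [List.cons_append]; exact h'.trans (List.suffix_cons _ _).isInfix)
      · exact Or.inr (Or.inl h')
      · exact Or.inr (Or.inr ⟨h1, ⟨d :: l', by rw [h2]; rfl⟩, h3⟩)

/-- An unblocked walk that starts along an edge and ends against an edge contains a collider
that descends from its first node, hence this node has a descendant in `S`. -/
theorem exists_descendant_of_not_blocks (hG : ∀ a b, G.Adj a b → ¬ G.Adj b a) {S : Set N} :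
    ∀ (l : List N) (x y e z : N), (x :: y :: l).IsChain (fun c d => G.Adj c d ∨ G.Adj d c) →
      ¬ G.Blocks S (x :: y :: l) → G.Adj x y → [e, z] <:+ x :: y :: l → G.Adj z e →
      ∃ d, Relation.ReflTransGen G.Adj x d ∧ d ∈ S
  | [], x, y, e, z, _, _, hxy, hs, hz => by
    have := List.IsSuffix.eq_of_length hs (by simp)
    simp only [List.cons.injEq, and_true] at this
    obtain ⟨rfl, rfl⟩ := this
    exact absurd hz (hG _ _ hxy)
  | w :: l, x, y, e, z, hc, hb, hxy, hs, hz => by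
    rw [List.isChain_cons_cons] at hc
    rcases (List.isChain_cons_cons.1 hc.2).1 with h | h
    · have hs' : [e, z] <:+ y :: w :: l := by
        rcases List.suffix_cons_iff.1 hs with h' | h'
        · simp at h'
        · exact h'
      obtain ⟨d, hd, hdS⟩ := exists_descendant_of_not_blocks hG l y w e z hc.2
        (fun h' => hb (h'.mono (List.suffix_cons _ _).isInfix)) h hs' hz
      exact ⟨d, .head hxy hd, hdS⟩
    · by_contra! hcon
      exact hb ⟨x, y, w, List.IsPrefix.isInfix ⟨l, by simp⟩,
        Or.inr ⟨⟨hxy, h⟩, fun d hd => hcon d (.head hxy hd)⟩⟩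

/-- Cutting a loop out of an unblocked walk leaves an unblocked walk. -/
theorem not_blocks_splice (hG : ∀ a b, G.Adj a b → ¬ G.Adj b a) {S : Set N} {l m n : List N}
    {x : N} (hc : (l ++ x :: m ++ x :: n).IsChain (fun c d => G.Adj c d ∨ G.Adj d c))
    (hb : ¬ G.Blocks S (l ++ x :: m ++ x :: n)) : ¬ G.Blocks S (l ++ x :: n) := by
  rintro ⟨a, b, c, hi, h⟩
  rcases triple_infix_append_cons hi with hi | hi | ⟨rfl, ⟨l, rfl⟩, ⟨n, rfl⟩⟩
  · exact hb ⟨a, b, c, hi.trans (List.IsPrefix.isInfix ⟨m ++ x :: n, by simp⟩), h⟩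
  · exact hb ⟨a, b, c, hi.trans (List.IsSuffix.isInfix ⟨l ++ x :: m, by simp⟩), h⟩
  -- Only the triple `a, b, c` at the junction is new. It is compared with the triples `a, b, d` and
  -- `f, b, c` at the two ends of the deleted loop.
  · have hcm : (b :: (m ++ [b])).IsChain (fun c d => G.Adj c d ∨ G.Adj d c) :=
      hc.infix ⟨l ++ [a], c :: n, by simp⟩
    have hbm : ¬ G.Blocks S (b :: (m ++ [b])) := fun h' => hb (h'.mono ⟨l ++ [a], c :: n, by simp⟩)
    obtain ⟨d, m', hm⟩ : ∃ d m', m ++ [b] = d :: m' := by cases m <;> simp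
    obtain ⟨f, m'', hm'⟩ : ∃ f m'', b :: m = m'' ++ [f] :=
      ⟨_, _, (List.dropLast_append_getLast (List.cons_ne_nil b m)).symm⟩
    have e1 : l ++ [a] ++ b :: m ++ b :: c :: n = l ++ ([a, b, d] ++ (m' ++ c :: n)) := by
      have : l ++ [a] ++ b :: m ++ b :: c :: n = l ++ a :: b :: ((m ++ [b]) ++ c :: n) := by simp
      rw [this, hm]; simp
    have e2 : l ++ [a] ++ b :: m ++ b :: c :: n = (l ++ [a] ++ m'') ++ ([f, b, c] ++ n) := by
      rw [List.append_assoc, List.append_assoc, List.append_assoc]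
      have : b :: m ++ b :: c :: n = m'' ++ ([f, b, c] ++ n) := by rw [hm']; simp
      rw [this]; simp
    have t1 : [a, b, d] <:+: l ++ [a] ++ b :: m ++ b :: c :: n := ⟨l, m' ++ c :: n, by rw [e1]; simp⟩
    have t2 : [f, b, c] <:+: l ++ [a] ++ b :: m ++ b :: c :: n :=
      ⟨l ++ [a] ++ m'', n, by rw [e2]; simp⟩
    have c1 := hc.infix t1
    have c2 := hc.infix t2
    simp only [List.isChain_cons_cons, List.isChain_singleton, and_true] at c1 c2
    have b1 := fun h' => hb ⟨a, b, d, t1, h'⟩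
    have b2 := fun h' => hb ⟨f, b, c, t2, h'⟩
    rcases h with ⟨h, hS⟩ | ⟨⟨hab, hcb⟩, hS⟩
    · have h1 : G.Adj b a → False := fun hba => b1 (Or.inl
        ⟨c1.2.elim (fun hbd => Or.inr (Or.inr ⟨hba, hbd⟩)) (fun hdb => Or.inr (Or.inl ⟨hdb, hba⟩)), hS⟩)
      rcases h with h | h | h
      · exact b2 (Or.inl ⟨c2.1.elim (fun hfb => Or.inl ⟨hfb, h.2⟩)
          (fun hbf => Or.inr (Or.inr ⟨hbf, h.2⟩)), hS⟩)
      · exact h1 h.2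
      · exact h1 h.1
    -- The junction is a collider. Either one of the old triples was already that collider, or the
    -- loop both starts and ends with an edge out of `b`; then it contains an open collider below
    -- `b`, which gives a descendant in `S`.
    · rcases c1.2 with hbd | hdb
      · rcases c2.1 with hfb | hbf
        · exact b2 (Or.inr ⟨⟨hfb, hcb⟩, hS⟩)
        · rw [hm] at hcm hbm
          obtain ⟨k, hk, hkS⟩ := exists_descendant_of_not_blocks hG m' b d f b hcm hbm hbd
            ⟨m'', by rw [← hm, ← List.cons_append, hm']; simp⟩ hbf
          exact hS k hk hkS
      · exact b1 (Or.inr ⟨⟨hab, hdb⟩, hS⟩)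

/-- An unblocked walk, possibly with repeated nodes, contradicts d-separation. -/
theorem not_dSep_of_walk (hG : ∀ a b, G.Adj a b → ¬ G.Adj b a) {S : Set N} {a b : N}
    (p : List N) (ha : p.head? = some a) (hb : p.getLast? = some b)
    (hc : p.IsChain (fun c d => G.Adj c d ∨ G.Adj d c)) (hp : ¬ G.Blocks S p) :
    ¬ G.DSep a b S := by
  induction hn : p.length using Nat.strong_induction_on generalizing p with
  | _ n ih =>
  subst hn
  by_cases hd : p.Nodup
  · exact fun h => hp (h p ⟨ha, hb, hd, hc⟩)
  · obtain ⟨x, hx⟩ := List.exists_duplicate_iff_not_nodup.2 hd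
    obtain ⟨l, m, n, rfl⟩ : ∃ l m n, p = l ++ x :: m ++ x :: n := by
      have hx' := List.duplicate_iff_sublist.1 hx
      obtain ⟨l, r, rfl, h1, h2⟩ := List.cons_sublist_iff.1 hx'
      obtain ⟨l1, l2, rfl⟩ := List.append_of_mem h1
      obtain ⟨r1, r2, rfl⟩ := List.append_of_mem (List.singleton_sublist.1 h2)
      exact ⟨l1, l2 ++ r1, r2, by simp⟩
    refine ih _ ?_ (l ++ x :: n) ?_ ?_ ?_ (not_blocks_splice hG hc hp) rfl
    · simp
    · cases l <;> simpa using ha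
    · simpa [List.getLast?_append, List.getLast?_cons] using hb
    · rw [List.isChain_split]
      exact ⟨hc.infix ⟨[], m ++ x :: n, by simp⟩, hc.infix ⟨l ++ x :: m, [], by simp⟩⟩

end Digraph

/-! ### Active walks and soundness of d-separation on outcomes. -/

namespace Digraph

variable {N : Type*} {G : Digraph N}

/-- There is an unblocked walk from `a` to `c` whose last node before `c`, if any,
satisfies `R`. -/
def ActiveWalk (G : Digraph N) (S : Set N) (a c : N) (R : N → Prop) : Prop :=
  ∃ p : List N, p.head? = some a ∧ p.getLast? = some c ∧
    p.IsChain (fun c d => G.Adj c d ∨ G.Adj d c) ∧ ¬ G.Blocks S p ∧ ∀ e, [e, c] <:+ p → R e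

theorem ActiveWalk.refl (G : Digraph N) (S : Set N) (a : N) (R : N → Prop) :
    G.ActiveWalk S a a R := by
  refine ⟨[a], rfl, rfl, by simp, ?_, fun e he => ?_⟩
  · rintro ⟨_, _, _, hi, -⟩
    simpa using hi.length_le
  · simpa using he.length_le

/-- An appended edge creates just one new triple, so the information `R` on the last edge suffices
to exclude blocking. -/
theorem ActiveWalk.snoc {S : Set N} {a c w : N} {R : N → Prop} (h : G.ActiveWalk S a c R)
    (hcw : G.Adj c w ∨ G.Adj w c)
    (hR : ∀ e, R e →
      ¬ ((((G.Adj e c ∧ G.Adj c w) ∨ (G.Adj w c ∧ G.Adj c e) ∨ (G.Adj c e ∧ G.Adj c w)) ∧ c ∈ S) ∨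
      ((G.Adj e c ∧ G.Adj w c) ∧ ∀ d, Relation.ReflTransGen G.Adj c d → d ∉ S))) :
    G.ActiveWalk S a w (fun e => e = c) := by
  obtain ⟨p, ha, hc, hp, hb, he⟩ := h
  obtain ⟨q, rfl⟩ : ∃ q, p = q ++ [c] := by
    obtain ⟨q, hq⟩ := List.getLast?_eq_some_iff.1 hc
    exact ⟨q, hq⟩
  refine ⟨q ++ [c] ++ [w], ?_, by simp, ?_, ?_, ?_⟩
  · rw [List.head?_append, ha]; rfl
  · rw [List.append_assoc, List.singleton_append, List.isChain_split]
    exact ⟨hp, by simpa using hcw⟩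
  · rintro ⟨x, y, z, hi, h⟩
    rw [List.append_assoc, List.singleton_append] at hi
    rcases triple_infix_append_cons hi with hi | hi | ⟨rfl, ⟨l, rfl⟩, ⟨n, hn⟩⟩
    · exact hb ⟨x, y, z, hi, h⟩
    · simpa using hi.length_le
    · simp only [List.cons.injEq] at hn
      obtain ⟨rfl, -⟩ := hn
      exact hR x (he x ⟨l, by simp⟩) h
  · intro e he
    rw [List.append_assoc] at he
    obtain ⟨t, ht⟩ := he
    have := (List.append_inj' ht (by simp)).2
    simp only [List.cons_append, List.nil_append, List.cons.injEq] at this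
    exact this.1

theorem ActiveWalk.mono {S : Set N} {a c : N} {R R' : N → Prop} (h : G.ActiveWalk S a c R)
    (hR : ∀ e, R e → R' e) : G.ActiveWalk S a c R' := by
  obtain ⟨p, h1, h2, h3, h4, h5⟩ := h
  exact ⟨p, h1, h2, h3, h4, fun e he => hR e (h5 e he)⟩

theorem ActiveWalk.not_dSep (hG : ∀ a b, G.Adj a b → ¬ G.Adj b a) {S : Set N} {a b : N}
    {R : N → Prop} (h : G.ActiveWalk S a b R) : ¬ G.DSep a b S := by
  obtain ⟨p, h1, h2, h3, h4, -⟩ := h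
  exact not_dSep_of_walk hG p h1 h2 h3 h4

/-- An unblocked walk from `a` to `c` that ends against an edge, or has length zero. -/
def UpReach (G : Digraph N) (S : Set N) (a c : N) : Prop := G.ActiveWalk S a c (fun e => G.Adj c e)

/-- An unblocked walk from `a` to `c` that ends along an edge, or has length zero. -/
def DownReach (G : Digraph N) (S : Set N) (a c : N) : Prop :=
  G.ActiveWalk S a c (fun e => G.Adj e c)

section steps

variable (hG : ∀ a b, G.Adj a b → ¬ G.Adj b a) {S : Set N} {a c w : N}
include hG

/-- A node entered against an edge cannot be a collider, so outside `S` it may be left either way. A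
node entered along an edge may be left downwards outside `S`, or upwards, as an open collider,
inside `S`. -/
theorem UpReach.up (h : G.UpReach S a c) (hc : c ∉ S) (hw : G.Adj w c) : G.UpReach S a w := by
  refine (ActiveWalk.snoc h (Or.inr hw) ?_).mono (by rintro e rfl; exact hw)
  rintro e he (⟨-, h'⟩ | ⟨⟨h', -⟩, -⟩)
  · exact hc h'
  · exact hG _ _ he h'

theorem UpReach.down (h : G.UpReach S a c) (hc : c ∉ S) (hw : G.Adj c w) : G.DownReach S a w := by
  refine (ActiveWalk.snoc h (Or.inl hw) ?_).mono (by rintro e rfl; exact hw)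
  rintro e he (⟨-, h'⟩ | ⟨⟨h', -⟩, -⟩)
  · exact hc h'
  · exact hG _ _ he h'

theorem DownReach.down (h : G.DownReach S a c) (hc : c ∉ S) (hw : G.Adj c w) :
    G.DownReach S a w := by
  refine (ActiveWalk.snoc h (Or.inl hw) ?_).mono (by rintro e rfl; exact hw)
  rintro e he (⟨-, h'⟩ | ⟨⟨-, h'⟩, -⟩)
  · exact hc h'
  · exact hG _ _ hw h'

theorem DownReach.up (h : G.DownReach S a c) (hc : c ∈ S) (hw : G.Adj w c) :
    G.UpReach S a w := by
  refine (ActiveWalk.snoc h (Or.inr hw) ?_).mono (by rintro e rfl; exact hw)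
  rintro e he (⟨h' | h' | h', -⟩ | ⟨-, h'⟩)
  · exact hG _ _ hw h'.2
  · exact hG _ _ he h'.2
  · exact hG _ _ hw h'.2
  · exact h' c .refl hc

end steps

/-- `w` is `v` or an ancestor of `v` along a directed path on which only `v` may lie in `S`. -/
def FreeAnc (G : Digraph N) (S : Set N) (w v : N) : Prop :=
  Relation.ReflTransGen (fun c d => G.Adj c d ∧ c ∉ S) w v

/-- The nodes whose noise is dependent on `a` given `S`. -/
def Linked (G : Digraph N) (S : Set N) (a w : N) : Prop :=
  (w ∉ S ∧ G.UpReach S a w) ∨ (w ∈ S ∧ G.DownReach S a w)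

section linked

variable (hG : ∀ a b, G.Adj a b → ¬ G.Adj b a) {S : Set N} {a w v : N}
include hG

theorem UpReach.of_freeAnc (h : G.UpReach S a v) (hv : v ∉ S) (hw : G.FreeAnc S w v) :
    w ∉ S ∧ G.UpReach S a w := by
  induction hw using Relation.ReflTransGen.head_induction_on with
  | refl => exact ⟨hv, h⟩
  | head h1 _ ih => exact ⟨h1.2, ih.2.up hG ih.1 h1.1⟩

theorem Linked.walk_of_freeAnc (h : G.Linked S a w) (hw : G.FreeAnc S w v) :
    G.DownReach S a v ∨ (v = w ∧ v ∉ S ∧ G.UpReach S a v) := by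
  induction hw with
  | refl => rcases h with h | h
            · exact Or.inr ⟨rfl, h⟩
            · exact Or.inl h.2
  | tail _ h1 ih =>
    rcases ih with ih | ih
    · exact Or.inl (ih.down hG h1.2 h1.1)
    · exact Or.inl (ih.2.2.down hG h1.2 h1.1)

/-- Conditioning on `v` couples its causes: the active walk descends from `w` to `v`, where the
collider is open, and climbs to `w'`. Hence the free ancestors of a node in `S` are all linked or
all unlinked. -/
theorem linked_of_mem (hv : v ∈ S) (h : G.Linked S a w) (hw : G.FreeAnc S w v) {w' : N}
    (hw' : G.FreeAnc S w' v) : G.Linked S a w' := by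
  have hd : G.DownReach S a v := (h.walk_of_freeAnc hG hw).resolve_right fun h' => h'.2.1 hv
  rcases Relation.ReflTransGen.cases_tail hw' with rfl | ⟨t, ht, htv⟩
  · exact Or.inr ⟨hv, hd⟩
  · exact Or.inl ((hd.up hG hv htv.1).of_freeAnc hG htv.2 ht)

theorem linked_of_freeAnc_self (ha : a ∉ S) (hw : G.FreeAnc S w a) : G.Linked S a w :=
  Or.inl (UpReach.of_freeAnc hG (ActiveWalk.refl G S a _) ha hw)

theorem DSep.not_linked {b : N} (h : G.DSep a b S) (hw : G.FreeAnc S w b) : ¬ G.Linked S a w := by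
  intro hl
  rcases hl.walk_of_freeAnc hG hw with h' | h'
  · exact ActiveWalk.not_dSep hG h' h
  · exact ActiveWalk.not_dSep hG h'.2.2 h

end linked

/-- Soundness of d-separation, in terms of outcomes. Every noise variable `k` acts directly on
one node `own k`, and `r n` is the relation that the node `n` has the same value in two outcomes;
it is determined by the parents of `n` and the noise that acts on `n`. If `S` d-separates `a` from
`b`, then there is a set of noise variables such that two outcomes with the same values on `S`
may be recombined along it, and `a` takes its value from the first one and `b` from the second. -/
theorem DSep.exists_recombine {U : Type*} {UVal : U → Type*} (hwf : WellFounded G.Adj)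
    (own : U → N) (r : N → Setoid (∀ k, UVal k))
    (hr : ∀ n u u', (∀ m, G.Adj m n → r m u u') → (∀ k, own k = n → u k = u' k) → r n u u')
    {S : Set N} {a b : N} (h : G.DSep a b S) :
    ∃ K : Set U, ∀ u u' v : ∀ k, UVal k, (∀ n ∈ S, r n u u') → (∀ k ∈ K, v k = u k) →
      (∀ k ∉ K, v k = u' k) → (∀ n ∈ S, r n v u) ∧ r a v u ∧ r b v u' := by
  have hG : ∀ a b, G.Adj a b → ¬ G.Adj b a := hwf.asymmetric
  by_cases ha : a ∈ S
  · refine ⟨∅, fun u u' v hS _ hv => ?_⟩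
    obtain rfl : v = u' := funext fun k => hv k (by simp)
    exact ⟨fun n hn => (r n).symm (hS n hn), (r a).symm (hS a ha), (r b).refl _⟩
  by_cases hb : b ∈ S
  · refine ⟨Set.univ, fun u u' v hS hv _ => ?_⟩
    obtain rfl : v = u := funext fun k => hv k (by simp)
    exact ⟨fun n _ => (r n).refl _, (r a).refl _, hS b hb⟩
  refine ⟨{k | G.Linked S a (own k)}, fun u u' v hS hv hv' => ?_⟩
  -- Nothing is claimed for a node outside `S` with both linked and unlinked free ancestors. The
  -- induction closes because a free ancestor of a parent outside `S` is also one of `n`, while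
  -- parents in `S` have the same value in `u`, `u'` and `v`.
  have key : ∀ n, (n ∈ S → r n v u) ∧
      (n ∉ S → (∀ w, G.FreeAnc S w n → G.Linked S a w) → r n v u) ∧
      (n ∉ S → (∀ w, G.FreeAnc S w n → ¬ G.Linked S a w) → r n v u') := by
    intro n
    induction n using hwf.induction with
    | _ n ih =>
    have h1 : (∀ w, G.FreeAnc S w n → G.Linked S a w) → r n v u := by
      intro hn
      refine hr n v u (fun m hm => ?_) (fun k hk => hv k ?_)
      · by_cases hmS : m ∈ S
        · exact (ih m hm).1 hmS
        · exact (ih m hm).2.1 hmS fun w hw => hn w (hw.tail ⟨hm, hmS⟩)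
      · exact hn _ (hk ▸ .refl)
    have h2 : (∀ w, G.FreeAnc S w n → ¬ G.Linked S a w) → r n v u' := by
      intro hn
      refine hr n v u' (fun m hm => ?_) (fun k hk => hv' k ?_)
      · by_cases hmS : m ∈ S
        · exact (r m).trans ((ih m hm).1 hmS) (hS m hmS)
        · exact (ih m hm).2.2 hmS fun w hw => hn w (hw.tail ⟨hm, hmS⟩)
      · exact hn _ (hk ▸ .refl)
    refine ⟨fun hn => ?_, fun _ => h1, fun _ => h2⟩
    by_cases hl : ∃ w, G.FreeAnc S w n ∧ G.Linked S a w
    · obtain ⟨w, hw, hwl⟩ := hl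
      exact h1 fun w' hw' => linked_of_mem hG hn hwl hw hw'
    · push Not at hl
      exact (r n).trans (h2 hl) ((r n).symm (hS n hn))
  exact ⟨fun n hn => (key n).1 hn, (key a).2.1 ha fun w hw => linked_of_freeAnc_self hG ha hw,
    (key b).2.2 hb fun w hw => h.not_linked hG hw⟩

end Digraph

/-! ### From recombination to conditional independence. -/

/-- If outcomes in `B` can be recombined along a set of independent noise variables so that `f`
depends on the first part only and `g` on the second part only, then `f` and `g` are independent
given `B`. -/
theorem indepFun_cond_of_recombine {U : Type*} [Finite U] {UVal : U → Type*}
    [∀ k, Countable (UVal k)] [∀ k, MeasurableSpace (UVal k)]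
    [∀ k, MeasurableSingletonClass (UVal k)] {P : Measure (∀ k, UVal k)} [IsProbabilityMeasure P]
    (hP : iIndepFun (fun (k : U) (u : ∀ k, UVal k) => u k) P)
    {α β : Type*} [MeasurableSpace α] [MeasurableSpace β] (f : (∀ k, UVal k) → α)
    (g : (∀ k, UVal k) → β) (B : Set (∀ k, UVal k)) (hB : P B ≠ 0) (K : Set U)
    (hK : ∀ u ∈ B, ∀ u' ∈ B, ∀ v : ∀ k, UVal k, (∀ k ∈ K, v k = u k) → (∀ k ∉ K, v k = u' k) →
      v ∈ B ∧ f v = f u ∧ g v = g u') :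
    IndepFun f g P[|B] := by
  classical
  cases nonempty_fintype U
  have hm : ∀ s : Set (∀ k, UVal k), MeasurableSet s := fun s => s.to_countable.measurableSet
  let I : Finset U := K.toFinset
  have hI : ∀ k, k ∈ I ↔ k ∈ K := fun k => Set.mem_toFinset
  let p : (∀ k, UVal k) → (∀ k : I, UVal k) := fun u k => u k
  let q : (∀ k, UVal k) → (∀ k : (Iᶜ : Finset U), UVal k) := fun u k => u k
  have hpq : IndepFun p q P :=
    hP.indepFun_finset I Iᶜ disjoint_compl_right (fun k => measurable_pi_apply k)
  have hmul : ∀ (s t : Set (∀ k, UVal k)),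
      P (p ⁻¹' (p '' s) ∩ q ⁻¹' (q '' t)) = P (p ⁻¹' (p '' s)) * P (q ⁻¹' (q '' t)) := fun s t =>
    hpq.measure_inter_preimage_eq_mul _ _ (Set.to_countable _).measurableSet
      (Set.to_countable _).measurableSet
  -- Recombination is exactly what makes such an event an intersection of a cylinder over `K` and a
  -- cylinder over its complement.
  have hsplit : ∀ s t, B ∩ f ⁻¹' s ∩ g ⁻¹' t =
      p ⁻¹' (p '' (B ∩ f ⁻¹' s)) ∩ q ⁻¹' (q '' (B ∩ g ⁻¹' t)) := by
    intro s t
    ext v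
    constructor
    · rintro ⟨⟨h1, h2⟩, h3⟩
      exact ⟨⟨v, ⟨h1, h2⟩, rfl⟩, ⟨v, ⟨h1, h3⟩, rfl⟩⟩
    · rintro ⟨⟨u, ⟨hu, hfu⟩, hpu⟩, ⟨u', ⟨hu', hgu⟩, hqu⟩⟩
      obtain ⟨h1, h2, h3⟩ := hK u hu u' hu' v
        (fun k hk => (congrFun hpu ⟨k, (hI k).2 hk⟩).symm)
        (fun k hk => (congrFun hqu ⟨k, Finset.mem_compl.2 fun h => hk ((hI k).1 h)⟩).symm)
      exact ⟨⟨h1, by rwa [Set.mem_preimage, h2]⟩, by rwa [Set.mem_preimage, h3]⟩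
  rw [indepFun_iff_measure_inter_preimage_eq_mul]
  intro s t _ _
  have e0 := hsplit Set.univ Set.univ
  have e1 := hsplit s Set.univ
  have e2 := hsplit Set.univ t
  have e3 := hsplit s t
  simp only [Set.preimage_univ, Set.inter_univ] at e0 e1 e2
  -- After factoring all four probabilities, both sides contain the same four factors.
  have key : P (B ∩ f ⁻¹' s ∩ g ⁻¹' t) * P B = P (B ∩ f ⁻¹' s) * P (B ∩ g ⁻¹' t) := by
    rw [e3, congrArg P e0, congrArg P e1, congrArg P e2, hmul, hmul, hmul, hmul]
    ring
  rw [cond_apply (hm B), cond_apply (hm B), cond_apply (hm B), ← Set.inter_assoc]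
  have hB' : P B ≠ ⊤ := measure_ne_top _ _
  calc (P B)⁻¹ * P (B ∩ f ⁻¹' s ∩ g ⁻¹' t)
      = (P B)⁻¹ * (P B)⁻¹ * (P (B ∩ f ⁻¹' s ∩ g ⁻¹' t) * P B) := by
        rw [mul_mul_mul_comm, ENNReal.inv_mul_cancel hB hB', mul_one]
    _ = _ := by rw [key]; ring

/-! ### The cross-world model: teleporters, consistency and locality. -/

namespace SCM

variable {V U : Type*} {Val : V → Type*} {UVal : U → Type*} (M : SCM V U Val UVal)

theorem wellFounded_graph [Finite V] : WellFounded M.graph.Adj := by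
  have he : ∀ k : U, Acc M.graph.Adj (Sum.inr k) := fun k =>
    ⟨_, fun b hb => by cases b <;> exact hb.elim⟩
  have hv : ∀ v : V, Acc M.graph.Adj (Sum.inl v) := fun v => by
    induction v using M.wellFounded_parent.induction with
    | _ v ih =>
    refine ⟨_, fun b hb => ?_⟩
    cases b with
    | inl w => exact ih w hb
    | inr k => exact he k
  exact ⟨fun a => by cases a; exacts [hv _, he _]⟩

theorem wellFounded_crossGraph [Finite V] (X : V) (x : Val X) :
    WellFounded (M.crossGraph X x).Adj := by
  have he : ∀ k h, Acc (M.crossGraph X x).Adj (.exo k h) := fun k h =>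
    ⟨_, fun b hb => by cases b <;> exact hb.elim⟩
  have hv : ∀ v : V, Acc (M.crossGraph X x).Adj (.real v) := fun v => by
    induction v using M.wellFounded_parent.induction with
    | _ v ih =>
    refine ⟨_, fun b hb => ?_⟩
    cases b with
    | real w => exact ih w hb
    | exo k h => exact he k h
    | cf w h => exact hb.elim
  have hc : ∀ v h, Acc (M.crossGraph X x).Adj (.cf v h) := fun v => by
    induction v using M.wellFounded_parent.induction with
    | _ v ih =>
    refine fun h => ⟨_, fun b hb => ?_⟩
    cases b with
    | real w => exact hv w
    | exo k h => exact he k h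
    | cf w h => exact ih w hb.2 h
  exact ⟨fun a => by cases a; exacts [hv _, he _ _, hc _ _]⟩

variable {M} {X : V} {x : Val X}

theorem IsTeleporter.ne {v : V} (h : M.IsTeleporter X x (Sum.inl v)) : v ≠ X := by
  rintro rfl
  obtain ⟨_, _, _, hi, -⟩ := h [Sum.inl v] ⟨rfl, rfl, by simp, by simp⟩
  simpa using hi.length_le

/-- An active path from `X` to `w` would extend along `w → v`: with nothing conditioned on, only
colliders block, and `w` is none since its last edge points away. -/
theorem IsTeleporter.of_parent [Finite V] {v w : V} (h : M.IsTeleporter X x (Sum.inl v))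
    (hw : M.parent w v) : M.IsTeleporter X x (Sum.inl w) := by
  by_contra hn
  have hG : ∀ a b, (M.intervene X x).graph.Adj a b → ¬ (M.intervene X x).graph.Adj b a :=
    (M.intervene X x).wellFounded_graph.asymmetric
  have hwv : (M.intervene X x).graph.Adj (Sum.inl w) (Sum.inl v) := ⟨h.ne, hw⟩
  unfold IsTeleporter Digraph.DSep at hn
  push Not at hn
  obtain ⟨p, ⟨h1, h2, -, h3⟩, h4⟩ := hn
  refine ((Digraph.ActiveWalk.snoc (R := fun _ => True) ⟨p, h1, h2, h3, h4, by simp⟩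
    (Or.inl hwv) ?_).not_dSep hG) h
  rintro e - (h' | h')
  · exact h'.2
  · exact hG _ _ hwv h'.1.2

theorem potential_eq_eqn [Finite V] {v : V} (hv : v ≠ X) (u : ∀ k, UVal k) :
    M.potential X x v u = M.eqn v (fun w => M.potential X x w u) (fun k => u k) := by
  unfold potential
  rw [solve_eq]
  simp only [intervene, dif_neg hv]

variable (M) in
theorem potential_self [Finite V] (X : V) (x : Val X) (u : ∀ k, UVal k) :
    M.potential X x X u = x := by
  unfold potential
  rw [solve_eq]
  simp only [intervene, dif_pos]

theorem IsTeleporter.potential_eq_solve [Finite V] {v : V} (h : M.IsTeleporter X x (Sum.inl v))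
    (u : ∀ k, UVal k) : M.potential X x v u = M.solve u v := by
  induction v using M.wellFounded_parent.induction with
  | _ v ih =>
  rw [potential_eq_eqn h.ne, solve_eq]
  congr 1
  exact funext fun w => ih w.1 w.2 (h.of_parent w.2)

/-- Consistency: where `X` has the value `x` in the real world, the counterfactual variables
coincide with the real ones. -/
theorem potential_eq_solve_of_eq [Finite V] {u : ∀ k, UVal k} (hu : M.solve u X = x) (v : V) :
    M.potential X x v u = M.solve u v := by
  induction v using M.wellFounded_parent.induction with
  | _ v ih =>
  by_cases hv : v = X
  · subst hv
    rw [potential_self, hu]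
  · rw [potential_eq_eqn hv, solve_eq]
    congr 1
    exact funext fun w => ih w.1 w.2

variable (M X x) in
/-- The relation that a node of the cross-world model has the same value in two outcomes. -/
noncomputable def crossSetoid [Finite V] : M.CrossNode X x → Setoid (∀ k, UVal k)
  | .real v => Setoid.ker fun u => M.solve u v
  | .exo k _ => Setoid.ker fun u => u k
  | .cf v _ => Setoid.ker fun u => M.potential X x v u

open Classical in
variable (M X x) in
/-- The node of the cross-world model on which an exogenous variable acts directly: its own node,
or the teleporter to which it belongs. -/
noncomputable def crossOwner (k : U) : M.CrossNode X x :=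
  if h : M.IsRemoved X x k then .real h.choose else .exo k h

theorem crossSetoid_local [Finite V] (n : M.CrossNode X x) (u u' : ∀ k, UVal k)
    (hp : ∀ m, (M.crossGraph X x).Adj m n → M.crossSetoid X x m u u')
    (hk : ∀ k, M.crossOwner X x k = n → u k = u' k) : M.crossSetoid X x n u u' := by
  match n, hp, hk with
  | .exo k h, hp, hk => exact hk k (dif_neg h)
  | .real v, hp, hk =>
    change M.solve u v = M.solve u' v
    rw [solve_eq, solve_eq]
    congr 1
    · exact funext fun w => hp (.real w) w.2
    · refine funext fun k => ?_
      by_cases h : M.IsRemoved X x k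
      · refine hk k ?_
        rw [crossOwner, dif_pos h]
        exact congrArg CrossNode.real ((h.choose_spec.2 v).1 k.2).symm
      · exact hp (.exo k h) k.2
  | .cf v hv, hp, hk =>
    change M.potential X x v u = M.potential X x v u'
    unfold potential
    rw [solve_eq, solve_eq]
    congr 1
    · refine funext fun w => ?_
      change M.potential X x w u = M.potential X x w u'
      by_cases h : M.IsTeleporter X x (Sum.inl w.1)
      · rw [h.potential_eq_solve, h.potential_eq_solve]
        exact hp (.real w) ⟨h, w.2⟩
      · exact hp (.cf w h) w.2
    · refine funext fun k => ?_
      -- The only child of removed noise is a teleporter, whereas `v` is not one.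
      have h : ¬ M.IsRemoved X x k := by
        rintro ⟨z, hz, hz'⟩
        obtain rfl := (hz' v).1 k.2.2
        exact hv hz
      exact hp (.exo k h) k.2

theorem crossSetoid_cfNode [Finite V] (Y : V) (u u' : ∀ k, UVal k) :
    M.crossSetoid X x (M.cfNode X x Y) u u' ↔
      M.potential X x Y u = M.potential X x Y u' := by
  by_cases h : M.IsTeleporter X x (Sum.inl Y)
  · rw [h.potential_eq_solve, h.potential_eq_solve, cfNode, dif_pos h]
    rfl
  · rw [cfNode, dif_neg h]
    rfl

/-! ### Conditional independence and the adjustment formula. -/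

section probability

variable [Finite V] [Finite U] [∀ v, MeasurableSpace (Val v)]
  [∀ k, Countable (UVal k)] [∀ k, MeasurableSpace (UVal k)]
  [∀ k, MeasurableSingletonClass (UVal k)]
  {P : Measure (∀ k, UVal k)} [IsProbabilityMeasure P]

/-- The counterfactual criterion. -/
theorem indepFun_potential_of_dSep (hP : iIndepFun (fun (k : U) (u : ∀ k, UVal k) => u k) P)
    {Y : V} {E Z : Set V}
    (hsep : (M.crossGraph X x).DSep (SCM.CrossNode.real X) (M.cfNode X x Y)
      (SCM.CrossNode.real '' (E ∪ Z)))
    (e : ∀ v : E, Val v) (z : ∀ v : Z, Val v) (h : P (M.event E e ∩ M.event Z z) ≠ 0) :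
    IndepFun (fun u => M.solve u X) (M.potential X x Y) P[|M.event E e ∩ M.event Z z] := by
  obtain ⟨K, hK⟩ := hsep.exists_recombine (M.wellFounded_crossGraph X x) (M.crossOwner X x)
    (M.crossSetoid X x) crossSetoid_local
  refine indepFun_cond_of_recombine hP _ _ _ h K fun u hu u' hu' v hv hv' => ?_
  have hS : ∀ n ∈ CrossNode.real '' (E ∪ Z), M.crossSetoid X x n u u' := by
    rintro _ ⟨w, hw | hw, rfl⟩
    · exact (hu.1 ⟨w, hw⟩).trans (hu'.1 ⟨w, hw⟩).symm
    · exact (hu.2 ⟨w, hw⟩).trans (hu'.2 ⟨w, hw⟩).symm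
  obtain ⟨h1, h2, h3⟩ := hK u u' v hS hv hv'
  refine ⟨⟨fun w => ?_, fun w => ?_⟩, h2, (crossSetoid_cfNode Y v u').1 h3⟩
  · exact (h1 _ ⟨w, Or.inl w.2, rfl⟩).trans (hu.1 w)
  · exact (h1 _ ⟨w, Or.inr w.2, rfl⟩).trans (hu.2 w)

/-- Cross-world adjustment: the adjustment formula follows from conditional independence. -/
theorem cond_potential_eq_tsum [∀ v, Countable (Val v)]
    [∀ v, MeasurableSingletonClass (Val v)] {Y : V} {E Z : Set V} (e : ∀ v : E, Val v) (y : Val Y)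
    (hind : ∀ z : ∀ v : Z, Val v, P (M.event E e ∩ M.event Z z) ≠ 0 →
      IndepFun (fun u => M.solve u X) (M.potential X x Y) P[|M.event E e ∩ M.event Z z])
    (hpos : ∀ z : ∀ v : Z, Val v, P (M.event Z z ∩ M.event E e) ≠ 0 →
        P (M.event Z z ∩ {u | M.solve u X = x} ∩ M.event E e) ≠ 0) :
    P[{u | M.potential X x Y u = y} | M.event E e] =
      ∑' z : ∀ v : Z, Val v,
        P[{u | M.solve u Y = y} | M.event Z z ∩ {u | M.solve u X = x} ∩ M.event E e] *
          P[M.event Z z | M.event E e] := by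
  have hm : ∀ s : Set (∀ k, UVal k), MeasurableSet s := fun s => s.to_countable.measurableSet
  have hunion : {u | M.potential X x Y u = y} =
      ⋃ z : ∀ v : Z, Val v, {u | M.potential X x Y u = y} ∩ M.event Z z := by
    rw [← Set.inter_iUnion]
    have huniv : ⋃ z : ∀ v : Z, Val v, M.event Z z = Set.univ :=
      Set.eq_univ_of_forall fun u =>
        Set.mem_iUnion.2 ⟨fun v : Z => M.solve u v, fun v : Z => rfl⟩
    rw [huniv, Set.inter_univ]
  rw [hunion, measure_iUnion ?_ fun _ => hm _]
  · refine tsum_congr fun z => ?_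
    rw [cond_apply (hm _), cond_apply (hm _), cond_apply (hm _)]
    -- Here the first factor on the right conditions on a null event, but the second factor is zero.
    by_cases h0 : P (M.event E e ∩ M.event Z z) = 0
    · have hD : P (M.event E e ∩ ({u | M.potential X x Y u = y} ∩ M.event Z z)) = 0 :=
        measure_mono_null (Set.inter_subset_inter_right _ Set.inter_subset_right) h0
      rw [h0, hD, mul_zero, mul_zero]
    have hx := hpos z (by rwa [Set.inter_comm])
    have key := (hind z h0).measure_inter_preimage_eq_mul {x} {y}
      (measurableSet_singleton _) (measurableSet_singleton _)
    rw [cond_apply (hm _), cond_apply (hm _), cond_apply (hm _)] at key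
    set B := M.event E e ∩ M.event Z z
    -- Consistency enters here: on `X = x` the potential outcome is the observed one.
    have s1 : B ∩ ((fun u => M.solve u X) ⁻¹' {x} ∩ M.potential X x Y ⁻¹' {y}) =
        M.event Z z ∩ {u | M.solve u X = x} ∩ M.event E e ∩ {u | M.solve u Y = y} := by
      ext u
      constructor
      · rintro ⟨⟨h1, h2⟩, h3, h4⟩
        exact ⟨⟨⟨h2, h3⟩, h1⟩, (potential_eq_solve_of_eq h3 Y).symm.trans h4⟩
      · rintro ⟨⟨⟨h2, h3⟩, h1⟩, h4⟩
        exact ⟨⟨h1, h2⟩, h3, (potential_eq_solve_of_eq h3 Y).trans h4⟩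
    have s2 : B ∩ (fun u => M.solve u X) ⁻¹' {x} =
        M.event Z z ∩ {u | M.solve u X = x} ∩ M.event E e := by
      ext u
      exact ⟨fun h => ⟨⟨h.1.2, h.2⟩, h.1.1⟩, fun h => ⟨⟨h.2, h.1.1⟩, h.1.2⟩⟩
    have s3 : B ∩ M.potential X x Y ⁻¹' {y} =
        M.event E e ∩ ({u | M.potential X x Y u = y} ∩ M.event Z z) := by
      ext u
      exact ⟨fun h => ⟨h.1.1, h.2, h.1.2⟩, fun h => ⟨⟨h.1, h.2.2⟩, h.2.1⟩⟩
    rw [s1, s2, s3] at key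
    have hB' : P B ≠ ⊤ := measure_ne_top _ _
    set C := M.event Z z ∩ {u | M.solve u X = x} ∩ M.event E e
    set D := M.event E e ∩ ({u | M.potential X x Y u = y} ∩ M.event Z z)
    have hC : P C ≠ ⊤ := measure_ne_top _ _
    have key' : P (C ∩ {u | M.solve u Y = y}) * P B = P C * P D := by
      have := congrArg (fun t => P B * P B * t) key
      calc P (C ∩ {u | M.solve u Y = y}) * P B
          = P B * (P B)⁻¹ * (P (C ∩ {u | M.solve u Y = y}) * P B) := by
            rw [ENNReal.mul_inv_cancel h0 hB', one_mul]
        _ = P B * P B * ((P B)⁻¹ * P (C ∩ {u | M.solve u Y = y})) := by ring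
        _ = P B * P B * ((P B)⁻¹ * P C * ((P B)⁻¹ * P D)) := this
        _ = (P B * (P B)⁻¹) * (P B * (P B)⁻¹) * (P C * P D) := by ring
        _ = P C * P D := by rw [ENNReal.mul_inv_cancel h0 hB', one_mul, one_mul]
    calc (P (M.event E e))⁻¹ * P D
        = (P (M.event E e))⁻¹ * ((P C)⁻¹ * P C * P D) := by
          rw [ENNReal.inv_mul_cancel hx hC, one_mul]
      _ = (P (M.event E e))⁻¹ * ((P C)⁻¹ * (P (C ∩ {u | M.solve u Y = y}) * P B)) := by
          rw [key', mul_assoc]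
      _ = _ := by ring
  · intro z z' hzz
    refine Set.disjoint_left.2 fun u hu hu' => hzz ?_
    exact funext fun v => (hu.2 v).symm.trans (hu'.2 v)

end probability

end SCM

theorem theorem3 {V U : Type*} [Finite V] [Finite U] {Val : V → Type*} {UVal : U → Type*}
    [∀ v, Countable (Val v)] [∀ v, MeasurableSpace (Val v)]
    [∀ v, MeasurableSingletonClass (Val v)]
    [∀ k, Countable (UVal k)] [∀ k, MeasurableSpace (UVal k)]
    [∀ k, MeasurableSingletonClass (UVal k)]
    (M : SCM V U Val UVal)
    (P : Measure (∀ k, UVal k)) [IsProbabilityMeasure P]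
    (hP : iIndepFun (fun (k : U) (u : ∀ k, UVal k) => u k) P)
    (X Y : V) (x : Val X) (E Z : Set V)
    (hsep : (M.crossGraph X x).DSep (SCM.CrossNode.real X) (M.cfNode X x Y)
      (SCM.CrossNode.real '' (E ∪ Z))) :
    (∀ (e : ∀ v : E, Val v) (z : ∀ v : Z, Val v), P (M.event E e ∩ M.event Z z) ≠ 0 →
      IndepFun (fun u => M.solve u X) (M.potential X x Y) P[|M.event E e ∩ M.event Z z]) ∧
    (∀ (e : ∀ v : E, Val v) (y : Val Y), P (M.event E e) ≠ 0 →
      (∀ z : ∀ v : Z, Val v, P (M.event Z z ∩ M.event E e) ≠ 0 →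
        P (M.event Z z ∩ {u | M.solve u X = x} ∩ M.event E e) ≠ 0) →
      P[{u | M.potential X x Y u = y} | M.event E e] =
        ∑' z : ∀ v : Z, Val v,
          P[{u | M.solve u Y = y} | M.event Z z ∩ {u | M.solve u X = x} ∩ M.event E e] *
            P[M.event Z z | M.event E e]) :=
  ⟨fun e z h => SCM.indepFun_potential_of_dSep hP hsep e z h,
    fun e y _ hpos => SCM.cond_potential_eq_tsum e y
      (fun z h => SCM.indepFun_potential_of_dSep hP hsep e z h) hpos⟩
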